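/- **Theorem 4.1 (resolvent approximation).** Let $M=X\cup_{S^1}Y$ be a smooth surface without boundary, where $X$ is compact with boundary $S^1=\mathbb R/\mathbb Z$, $Y=[1,\infty)\times S^1$, and $X\cap Y=\partial X=\partial Y=\{1\}\times S^1$. For each $a\in(0,\infty)$ let $g_a$ be a smooth Riemannian metric on $M$ with $$g_a|_Y=dx^2+\Big(1+\frac xa\Big)^{-2a}dy^2,\qquad (x,y)\in[1,\infty)\times S^1$$ (the dependence of $g_a|_X$ on $a$ is arbitrary), and let $g_{\mathbb H}$ be a smooth Riemannian metric on $M$ with $g_{\mathbb H}|_Y=dx^2+e^{-2x}dy^2$. Let $\Delta_{\mathbb M}=\Delta_{\mathbb M,a}$ and $\Delta_{\mathbb H}$ be the Laplace operators $\operatorname{div}\operatorname{grad}$ of $g_a$ and $g_{\mathbb H}$. Let $L^2(\mathbb M_{\mathbb H})$ be the space of complex-valued functions that are square integrable for the Riemannian measure of $g_{\mathbb H}$, and let $\underline\Delta_{\mathbb H}$ be the closure in $L^2(\mathbb M_{\mathbb H})$ of $\Delta_{\mathbb H}$ with domain $C_0^\infty(M)$. Then for every $\phi\in C_0^\infty(Y\setminus\partial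 Y)$ (complex-valued, extended by zero to $M$) and every $\lambda$ in the resolvent set of $\underline\Delta_{\mathbb H}$, the functions $\phi$ and $(\Delta_{\mathbb M}-\lambda)\phi$, $a>0$, belong to $L^2(\mathbb M_{\mathbb H})$, and $$\big\|(\underline\Delta_{\mathbb H}-\lambda)^{-1}(\Delta_{\mathbb M}-\lambda)\phi-\phi\big\|_{L^2(\mathbb M_{\mathbb H})}\longrightarrow0\qquad\text{as } a\to\infty.$$ -/

import Mathlib

open Set Filter Topology MeasureTheory
open scoped Manifold ContDiff

noncomputable section

namespace CuspSurface

/-- The Euclidean plane, used as the model space of surfaces and as the space of coordinates. -/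
abbrev Plane : Type := EuclideanSpace ℝ (Fin 2)

/-- The `i`-th coordinate vector. -/
def coordVec (i : Fin 2) : Plane := EuclideanSpace.single i (1 : ℝ)

/-- Smooth Riemannian metrics on a surface `M`. -/
abbrev Metric (M : Type*) [TopologicalSpace M] [ChartedSpace Plane M]
    [IsManifold (𝓡 2) ∞ M] : Type _ :=
  Bundle.ContMDiffRiemannianMetric (𝓡 2) ∞ Plane (fun p : M => TangentSpace (𝓡 2) p)

/-- A cylindrical end of the surface `M`: a decomposition `M = X ∪ Y` with `X` compact,
`Y = [1,∞) × S¹`, `S¹ = ℝ / ℤ`, and `X ∩ Y = {1} × S¹`.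
The end is given by a parametrization `(x, y) ↦ param (x, y)` that is periodic with period `1` in
the variable `y`. Since `Y` is smoothly embedded up to its boundary, the
parametrization is defined (as a smooth embedding of a cylinder) a bit beyond the boundary circle,
for `x > 1 - collar`. -/
structure CylindricalEnd (M : Type*) [TopologicalSpace M] [ChartedSpace Plane M] where
  /-- The parametrization; only its values for `x > 1 - collar` matter. -/
  param : Plane → M
  /-- The width of the collar inside `X`. -/
  collar : ℝ
  collar_pos : 0 < collar
  contMDiffOn_param : ContMDiffOn (𝓡 2) (𝓡 2) ∞ param {p | 1 - collar < p 0}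
  param_eq_iff : ∀ p q : Plane, 1 - collar < p 0 → 1 - collar < q 0 →
    (param p = param q ↔ p 0 = q 0 ∧ ∃ n : ℤ, q 1 = p 1 + n)
  bijective_mfderiv_param : ∀ p : Plane, 1 - collar < p 0 →
    Function.Bijective (mfderiv (𝓡 2) (𝓡 2) param p)
  /-- `Y` is a closed subset of `M`. -/
  isClosed_end : IsClosed (param '' {p | 1 ≤ p 0})
  /-- `X`, the complement of `Y ∖ ∂Y`, is compact. -/
  isCompact_core : IsCompact (param '' {p | 1 < p 0})ᶜ

section Basic

variable {M : Type*} [TopologicalSpace M] [ChartedSpace Plane M]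

/-- The open subset `Y ∖ ∂Y = (1,∞) × S¹` of `M`. -/
def CylindricalEnd.openEnd (Y : CylindricalEnd M) : Set M := Y.param '' {p | 1 < p 0}

variable [IsManifold (𝓡 2) ∞ M]

/-- The restriction of the metric `g` to `Y` is the warped product `dx² + f(x)² dy²`. -/
def IsWarpedOnEnd (g : Metric M) (Y : CylindricalEnd M) (f : ℝ → ℝ) : Prop :=
  ∀ p : Plane, 1 ≤ p 0 → ∀ v w : Plane,
    g.inner (Y.param p) (mfderiv (𝓡 2) (𝓡 2) Y.param p v) (mfderiv (𝓡 2) (𝓡 2) Y.param p w) =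
      v 0 * w 0 + f (p 0) ^ 2 * (v 1 * w 1)

/-- The matrix `(g_ij)` of the metric in the preferred chart at `c`, at the point with
coordinates `z`. -/
def metricMatrix (g : Metric M) (c : M) (z : Plane) : Matrix (Fin 2) (Fin 2) ℝ :=
  Matrix.of fun i j => g.inner ((chartAt Plane c).symm z)
    (mfderiv (𝓡 2) (𝓡 2) (chartAt Plane c).symm z (coordVec i))
    (mfderiv (𝓡 2) (𝓡 2) (chartAt Plane c).symm z (coordVec j))

/-- The density `√det (g_ij)` of the Riemannian measure in the preferred chart at `c`. -/
def sqrtDet (g : Metric M) (c : M) (z : Plane) : ℝ :=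
  √(metricMatrix g c z).det

/-- The `i`-th component of `√det(g) ∇u` in the preferred chart at `c`,
`√det(g) ∑_j g^{ij} ∂_j u`. -/
def flux (g : Metric M) (c : M) (u : M → ℂ) (i : Fin 2) (z : Plane) : ℂ :=
  ∑ j, ((sqrtDet g c z * (metricMatrix g c z)⁻¹ i j : ℝ) : ℂ) *
    fderiv ℝ (fun w => u ((chartAt Plane c).symm w)) z (coordVec j)

/-- The Laplace operator `Δ u = div grad u = det(g)^{-1/2} ∑_i ∂_i (det(g)^{1/2} ∑_j g^{ij} ∂_j u)`
of the metric `g`, acting on smooth functions; the value at `p` is computed in the preferred chart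
at `p`. -/
def laplacian (g : Metric M) (u : M → ℂ) (p : M) : ℂ :=
  ((sqrtDet g p (chartAt Plane p p))⁻¹ : ℂ) *
    ∑ i, fderiv ℝ (flux g p u i) (chartAt Plane p p) (coordVec i)

variable [T2Space M] [SigmaCompactSpace M]

variable (M) in
/-- A smooth partition of unity on `M`, subordinate to the domains of the preferred charts. -/
def chartPartition : SmoothPartitionOfUnity M (𝓡 2) M univ :=
  (SmoothPartitionOfUnity.exists_isSubordinate_chartAt_source (𝓡 2) M).choose

variable [MeasurableSpace M]

/-- The measure `√det(g) dz` in the preferred chart at `c`, as a measure on `M` that is carried by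
the domain of this chart. -/
def chartMeasure (g : Metric M) (c : M) : Measure M :=
  ((volume.restrict (chartAt Plane c).target).withDensity
    fun z => ENNReal.ofReal (sqrtDet g c z)).map (chartAt Plane c).symm

/-- The Riemannian measure of `g`, `A ↦ ∑_c ∫_A ρ_c √det(g) dz`, where `(ρ_c)` is a partition of
unity subordinate to the charts. -/
def riemannianMeasure (g : Metric M) : Measure M :=
  Measure.sum fun c : M =>
    (chartMeasure g c).withDensity fun p => ENNReal.ofReal (chartPartition M c p)

/-- The Hilbert space of complex functions that are square integrable with respect to the
Riemannian measure of `g`. -/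
abbrev L2 (g : Metric M) : Type _ := Lp ℂ 2 (riemannianMeasure g)

/-- The closure in `L²` of the Laplace operator of `g` with domain `C_0^∞(M)`. An unbounded operator
is represented by its graph, so that this is the closure of the set of pairs `(ψ, Δψ)`. -/
def closedLaplacian (g : Metric M) : Submodule ℂ (L2 g × L2 g) :=
  (Submodule.span ℂ {w : L2 g × L2 g | ∃ ψ : M → ℂ, ContMDiff (𝓡 2) 𝓘(ℝ, ℂ) ∞ ψ ∧
    HasCompactSupport ψ ∧ w.1 =ᵐ[riemannianMeasure g] ψ ∧
    w.2 =ᵐ[riemannianMeasure g] laplacian g ψ}).topologicalClosure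

end Basic

section Resolvent

variable {H : Type*} [NormedAddCommGroup H] [NormedSpace ℂ H]

/-- The bounded operator `R` is the inverse `(T - lam)⁻¹`, for an unbounded operator `T` given by
its graph: `R w = u` if and only if `u` is in the domain of `T` and `T u - lam u = w`. -/
def IsResolventAt (T : Submodule ℂ (H × H)) (lam : ℂ) (R : H →L[ℂ] H) : Prop :=
  ∀ u w : H, R w = u ↔ (u, w + lam • u) ∈ T

/-- The set of all `lam` such that `T - lam` has a bounded inverse defined on the whole space. -/
def resolventSetOf (T : Submodule ℂ (H × H)) : Set ℂ :=
  {lam | ∃ R : H →L[ℂ] H, IsResolventAt T lam R}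

open Classical in
/-- The resolvent `(T - lam)⁻¹`, for `lam` in the resolvent set of `T` (and `0` otherwise). -/
def resolventOf (T : Submodule ℂ (H × H)) (lam : ℂ) : H →L[ℂ] H :=
  if h : ∃ R : H →L[ℂ] H, IsResolventAt T lam R then h.choose else 0

end Resolvent

end CuspSurface

end

/-! Since `φ` lies in the core `C_0^∞(M)`, the pair `(φ, Δ_H φ)` is in the graph of the closed
operator, so the resolvent `R` sends `(Δ_H - lam) φ` to `φ`. Hence `R (Δ_M - lam) φ - φ = R (Δ_M φ -
Δ_H φ)`, and as `R` is bounded and independent of `a`, it suffices that `Δ_M φ → Δ_H φ` in `L²`.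

Both sides vanish off the compact support of `φ`, which lies in the open end. There a warped product
`dx² + f² dy²` has Laplacian `u_xx + (f'/f) u_x + f⁻² u_yy` (`laplacian_param`), so the difference
is `(1 - (1 + x/a)⁻¹) u_x + ((1 + x/a)^(2a) - e^(2x)) u_yy` (`warpedLaplacian_sub`). It tends to
zero pointwise, and `(1 + x/a)^a ≤ e^x` bounds it uniformly in `a`. The support has finite measure
(`riemannianMeasure_lt_top`), so dominated convergence concludes.

Most of the work goes into deriving the formula for the Laplacian from its definition in the charts
of the atlas. -/

noncomputable section

namespace CuspSurface

/-! ### Charts of the atlas versus cylinder coordinates -/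

section CoordinateChange

/-- The partial derivative `∂_i u`. -/
def pderiv {F : Type*} [NormedAddCommGroup F] [NormedSpace ℝ F] (i : Fin 2) (u : Plane → F)
    (z : Plane) : F :=
  fderiv ℝ u z (coordVec i)

/-- The partial derivative `∂_i σ_k` of the `k`-th component of a map of planes. -/
def jacEntry (σ : Plane → Plane) (i k : Fin 2) (z : Plane) : ℝ :=
  fderiv ℝ σ z (coordVec i) k

/-- The Jacobian determinant of a map of planes. -/
def jac (σ : Plane → Plane) (z : Plane) : ℝ :=
  jacEntry σ 0 0 z * jacEntry σ 1 1 z - jacEntry σ 1 0 z * jacEntry σ 0 1 z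

lemma eq_sum_coordVec (v : Plane) : v = v 0 • coordVec 0 + v 1 • coordVec 1 := by
  ext i
  fin_cases i <;> simp [coordVec]

lemma jac_ne_zero_of_injective {σ : Plane → Plane} {z : Plane}
    (h : Function.Injective (fderiv ℝ σ z)) : jac σ z ≠ 0 := by
  intro h0
  have key : ∀ x y : ℝ, x * jacEntry σ 0 0 z + y * jacEntry σ 1 0 z = 0 →
      x * jacEntry σ 0 1 z + y * jacEntry σ 1 1 z = 0 → x = 0 ∧ y = 0 := by
    intro x y h1 h2
    have h3 : fderiv ℝ σ z (x • coordVec 0 + y • coordVec 1) = 0 := by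
      rw [map_add, map_smul, map_smul]
      ext i
      fin_cases i
      · simpa [jacEntry] using h1
      · simpa [jacEntry] using h2
    have h4 := h (h3.trans (map_zero _).symm)
    constructor
    · simpa [coordVec] using congrArg (fun v : Plane => v 0) h4
    · simpa [coordVec] using congrArg (fun v : Plane => v 1) h4
  unfold jac at h0
  -- The columns of the adjugate lie in the kernel when the determinant vanishes; injectivity then
  -- makes every entry zero.
  have k1 := key (jacEntry σ 1 1 z) (-jacEntry σ 0 1 z) (by linarith) (by ring)
  have k2 := key (-jacEntry σ 1 0 z) (jacEntry σ 0 0 z) (by ring) (by linarith)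
  have := key 1 0 (by simp [k2.2]) (by linarith [k1.2])
  exact one_ne_zero this.1

lemma contDiffAt_jacEntry {σ : Plane → Plane} {z : Plane} (h : ContDiffAt ℝ 2 σ z)
    (i k : Fin 2) : ContDiffAt ℝ 1 (jacEntry σ i k) z := by
  have h1 : ContDiffAt ℝ 1 (fderiv ℝ σ) z := h.fderiv_right (by norm_num)
  have h2 : ContDiffAt ℝ 1 (fun z => fderiv ℝ σ z (coordVec i)) z := h1.clm_apply contDiffAt_const
  exact (EuclideanSpace.proj (𝕜 := ℝ) k).contDiff.contDiffAt.comp z h2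

lemma continuousAt_jac {σ : Plane → Plane} {z : Plane} (h : ContDiffAt ℝ 2 σ z) :
    ContinuousAt (jac σ) z := by
  have h' := fun i k => (contDiffAt_jacEntry h i k).continuousAt
  exact ((h' 0 0).mul (h' 1 1)).sub ((h' 1 0).mul (h' 0 1))

variable {M : Type*} [TopologicalSpace M] [ChartedSpace Plane M]

lemma CylindricalEnd.contMDiffAt_param (Y : CylindricalEnd M) {q : Plane}
    (hq : 1 - Y.collar < q 0) : ContMDiffAt (𝓡 2) (𝓡 2) ∞ Y.param q := by
  refine Y.contMDiffOn_param.contMDiffAt (IsOpen.mem_nhds ?_ hq)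
  exact isOpen_lt continuous_const (by fun_prop)

/-- `σ` is, near `z`, a lift of the inverse of the chart at `c` to cylinder coordinates. -/
def IsCoordChangeAt (Y : CylindricalEnd M) (c : M) (σ : Plane → Plane) (z : Plane) : Prop :=
  ContDiffAt ℝ 2 σ z ∧ Y.param (σ z) = (chartAt Plane c).symm z ∧ z ∈ (chartAt Plane c).target ∧
    1 < σ z 0 ∧ jac σ z ≠ 0

lemma mfderiv_chart_symm {Y : CylindricalEnd M} {c : M} {σ : Plane → Plane} {z : Plane}
    (h : ∀ᶠ w in 𝓝 z, IsCoordChangeAt Y c σ w) (v : Plane) :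
    mfderiv (𝓡 2) (𝓡 2) (chartAt Plane c).symm z v =
      mfderiv (𝓡 2) (𝓡 2) Y.param (σ z) (fderiv ℝ σ z v) := by
  have hz := h.self_of_nhds
  have hq : 1 - Y.collar < σ z 0 := by linarith [Y.collar_pos, hz.2.2.2.1]
  have h1 : (chartAt Plane c).symm =ᶠ[𝓝 z] Y.param ∘ σ := h.mono fun w hw => hw.2.1.symm
  have h2 : mfderiv (𝓡 2) (𝓡 2) (Y.param ∘ σ) z =
      (mfderiv (𝓡 2) (𝓡 2) Y.param (σ z)).comp (mfderiv (𝓡 2) (𝓡 2) σ z) :=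
    mfderiv_comp z ((Y.contMDiffAt_param hq).mdifferentiableAt (by simp))
      (hz.1.contMDiffAt.mdifferentiableAt (by simp))
  -- The ascription to `Plane →L[ℝ] Plane` identifies tangent spaces at base points that are equal
  -- only propositionally.
  have h3 : (mfderiv (𝓡 2) (𝓡 2) (chartAt Plane c).symm z : Plane →L[ℝ] Plane) =
      mfderiv (𝓡 2) (𝓡 2) (Y.param ∘ σ) z := h1.mfderiv_eq
  have h4 := congrArg (fun L : Plane →L[ℝ] Plane => L v) (h3.trans h2)
  have h5 : (mfderiv (𝓡 2) (𝓡 2) σ z : Plane →L[ℝ] Plane) = fderiv ℝ σ z := mfderiv_eq_fderiv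
  rw [← h5]
  exact h4

variable [IsManifold (𝓡 2) ∞ M]

/-- The inverse function theorem applies to the chart composed with `Y.param`, whose derivative is a
composite of two bijections. The remaining conditions are open and hold at the centre. -/
lemma CylindricalEnd.exists_coordChange (Y : CylindricalEnd M) {q : Plane} (hq : 1 < q 0) {c : M}
    (hc : Y.param q ∈ (chartAt Plane c).source) :
    ∃ σ : Plane → Plane, σ (chartAt Plane c (Y.param q)) = q ∧
      ∀ᶠ z in 𝓝 (chartAt Plane c (Y.param q)), IsCoordChangeAt Y c σ z := by
  have hq' : 1 - Y.collar < q 0 := by linarith [Y.collar_pos]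
  have hP := Y.contMDiffAt_param hq'
  have hchart : ContMDiffAt (𝓡 2) (𝓡 2) ∞ (chartAt Plane c) (Y.param q) :=
    (contMDiffOn_chart (I := 𝓡 2) (n := ∞) (x := c)).contMDiffAt
      ((chartAt Plane c).open_source.mem_nhds hc)
  set κ : Plane → Plane := fun w => chartAt Plane c (Y.param w) with hκ
  have hκs : ContDiffAt ℝ ∞ κ q := (hchart.comp q hP).contDiffAt
  have hbij : Function.Bijective (fderiv ℝ κ q) := by
    have h1 : mfderiv (𝓡 2) (𝓡 2) κ q =
        (mfderiv (𝓡 2) (𝓡 2) (chartAt Plane c) (Y.param q)).comp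
          (mfderiv (𝓡 2) (𝓡 2) Y.param q) :=
      mfderiv_comp q (hchart.mdifferentiableAt (by simp)) (hP.mdifferentiableAt (by simp))
    have h2 : fderiv ℝ κ q = mfderiv (𝓡 2) (𝓡 2) κ q := mfderiv_eq_fderiv.symm
    have h3 := ((mdifferentiable_chart (I := 𝓡 2) c).mfderiv_bijective hc).comp
      (Y.bijective_mfderiv_param q hq')
    rw [h2, h1]
    exact h3
  let e : Plane ≃L[ℝ] Plane :=
    (LinearEquiv.ofBijective (fderiv ℝ κ q : Plane →ₗ[ℝ] Plane) hbij).toContinuousLinearEquiv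
  have he : (e : Plane →L[ℝ] Plane) = fderiv ℝ κ q := by ext; rfl
  have hd : HasFDerivAt κ (e : Plane →L[ℝ] Plane) q := by
    rw [he]; exact (hκs.differentiableAt (by simp)).hasFDerivAt
  have hstrict : HasStrictFDerivAt κ (e : Plane →L[ℝ] Plane) q :=
    hκs.hasStrictFDerivAt' hd (by simp)
  set σ : Plane → Plane := hstrict.localInverse κ e q with hσ
  have hσq : σ (κ q) = q := hstrict.localInverse_apply_image
  have hσs : ContDiffAt ℝ ∞ σ (κ q) := hκs.to_localInverse hd (by simp)
  have hσ2 : ContDiffAt ℝ 2 σ (κ q) := hσs.of_le (by norm_cast)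
  have hσc : ContinuousAt σ (κ q) := hσs.continuousAt
  have hσd : fderiv ℝ σ (κ q) = (e.symm : Plane →L[ℝ] Plane) :=
    hstrict.to_localInverse.hasFDerivAt.fderiv
  have hjac : jac σ (κ q) ≠ 0 := by
    apply jac_ne_zero_of_injective
    rw [hσd]
    exact e.symm.injective
  refine ⟨σ, hσq, ?_⟩
  have e1 := hstrict.eventually_right_inverse
  have e2 : ∀ᶠ z in 𝓝 (κ q), ContDiffAt ℝ 2 σ z := hσ2.eventually (by simp)
  have e3 : ∀ᶠ z in 𝓝 (κ q), z ∈ (chartAt Plane c).target :=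
    (chartAt Plane c).open_target.mem_nhds ((chartAt Plane c).map_source hc)
  have e4 : ∀ᶠ z in 𝓝 (κ q), 1 < σ z 0 := by
    have : ContinuousAt (fun z => σ z 0) (κ q) :=
      (EuclideanSpace.proj (𝕜 := ℝ) (0 : Fin 2)).continuous.continuousAt.comp hσc
    refine this.eventually_const_lt ?_
    simpa only [hσq] using hq
  have e5 : ∀ᶠ z in 𝓝 (κ q), jac σ z ≠ 0 := (continuousAt_jac hσ2).eventually_ne hjac
  have e6 : ∀ᶠ z in 𝓝 (κ q), Y.param (σ z) ∈ (chartAt Plane c).source := by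
    have : ContinuousAt (fun z => Y.param (σ z)) (κ q) := by
      apply ContinuousAt.comp _ hσc
      rw [hσq]; exact hP.continuousAt
    refine this ((chartAt Plane c).open_source.mem_nhds ?_)
    simpa only [hσq] using hc
  filter_upwards [e1, e2, e3, e4, e5, e6] with z h1 h2 h3 h4 h5 h6
  refine ⟨h2, ?_, h3, h4, h5⟩
  conv_rhs => rw [← h1]
  exact ((chartAt Plane c).left_inv h6).symm

lemma metricMatrix_eq {g : Metric M} {Y : CylindricalEnd M} {f : ℝ → ℝ}
    (hg : IsWarpedOnEnd g Y f) {c : M} {σ : Plane → Plane} {z : Plane}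
    (h : ∀ᶠ w in 𝓝 z, IsCoordChangeAt Y c σ w) (i j : Fin 2) :
    metricMatrix g c z i j = jacEntry σ i 0 z * jacEntry σ j 0 z +
      f (σ z 0) ^ 2 * (jacEntry σ i 1 z * jacEntry σ j 1 z) := by
  have hz := h.self_of_nhds
  have hp : ∀ (p p' : M) (_ : p = p') (v w : Plane),
      g.inner p v w = g.inner p' v w := by rintro p _ rfl v w; rfl
  refine (hp _ _ hz.2.1.symm _ _).trans ?_
  rw [mfderiv_chart_symm h, mfderiv_chart_symm h]
  exact hg (σ z) hz.2.2.2.1.le _ _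

/-- The metric matrix is `J diag(1, f²) Jᵀ` with `J` the Jacobian matrix of `σ`, so its determinant
is a square. -/
lemma sqrtDet_eq {g : Metric M} {Y : CylindricalEnd M} {f : ℝ → ℝ}
    (hg : IsWarpedOnEnd g Y f) (hf : ∀ x, 1 < x → 0 < f x) {c : M} {σ : Plane → Plane} {z : Plane}
    (h : ∀ᶠ w in 𝓝 z, IsCoordChangeAt Y c σ w) :
    sqrtDet g c z = f (σ z 0) * |jac σ z| := by
  have hz := h.self_of_nhds
  rw [sqrtDet, Matrix.det_fin_two]
  simp only [metricMatrix_eq hg h]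
  have h0 : 0 ≤ f (σ z 0) * |jac σ z| := mul_nonneg (hf _ hz.2.2.2.1).le (abs_nonneg _)
  rw [← Real.sqrt_sq h0]
  congr 1
  rw [mul_pow, sq_abs, jac]
  ring

end CoordinateChange

/-! ### The Laplacian of a warped product under a change of coordinates -/

section ChartComputation

variable {M : Type*} [TopologicalSpace M] [ChartedSpace Plane M]

/-- The Laplacian of the warped product `dx² + f(x)² dy²` on the plane. -/
def warpedLaplacian (f : ℝ → ℝ) (u : Plane → ℂ) (w : Plane) : ℂ :=
  pderiv 0 (pderiv 0 u) w + ((deriv f (w 0) / f (w 0) : ℝ) : ℂ) * pderiv 0 u w +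
    (((f (w 0))⁻¹ ^ 2 : ℝ) : ℂ) * pderiv 1 (pderiv 1 u) w

lemma contDiffAt_pderiv {u : Plane → ℂ} {z : Plane} (h : ContDiffAt ℝ 2 u z) (i : Fin 2) :
    ContDiffAt ℝ 1 (pderiv i u) z :=
  (h.fderiv_right (m := 1) (by norm_num)).clm_apply contDiffAt_const

lemma continuousAt_pderiv_pderiv {u : Plane → ℂ} {z : Plane} (h : ContDiffAt ℝ 2 u z)
    (i j : Fin 2) : ContinuousAt (pderiv i (pderiv j u)) z := by
  have h1 := (contDiffAt_pderiv h j).fderiv_right (m := 0) (by norm_num)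
  exact h1.continuousAt.clm_apply continuousAt_const

lemma fderiv_apply_coordVec (σ : Plane → Plane) (z : Plane) (j : Fin 2) :
    fderiv ℝ σ z (coordVec j) = jacEntry σ j 0 z • coordVec 0 + jacEntry σ j 1 z • coordVec 1 :=
  eq_sum_coordVec _

lemma pderiv_comp {v : Plane → ℂ} {σ : Plane → Plane} {z : Plane}
    (hv : DifferentiableAt ℝ v (σ z)) (hσ : DifferentiableAt ℝ σ z) (j : Fin 2) :
    pderiv j (fun w => v (σ w)) z =
      (jacEntry σ j 0 z : ℂ) * pderiv 0 v (σ z) + (jacEntry σ j 1 z : ℂ) * pderiv 1 v (σ z) := by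
  have h : fderiv ℝ (fun w => v (σ w)) z = (fderiv ℝ v (σ z)).comp (fderiv ℝ σ z) :=
    fderiv_comp z hv hσ
  rw [pderiv, h, ContinuousLinearMap.comp_apply, fderiv_apply_coordVec]
  simp [pderiv]

/-- The symmetry of second derivatives, for the components of a map of planes. -/
lemma pderiv_jacEntry_comm {σ : Plane → Plane} {z : Plane} (h : ContDiffAt ℝ 2 σ z)
    (i j k : Fin 2) : pderiv i (jacEntry σ j k) z = pderiv j (jacEntry σ i k) z := by
  have hd : DifferentiableAt ℝ (fderiv ℝ σ) z :=
    (h.fderiv_right (m := 1) (by norm_num)).differentiableAt (by simp)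
  have key : ∀ i j, pderiv i (jacEntry σ j k) z =
      (fderiv ℝ (fderiv ℝ σ) z (coordVec i) (coordVec j)) k := by
    intro i j
    have h1 := (hd.hasFDerivAt.clm_apply (hasFDerivAt_const (coordVec j) z))
    have h2 := ((EuclideanSpace.proj (𝕜 := ℝ) k : Plane →L[ℝ] ℝ).hasFDerivAt).comp z h1
    have h3 : HasFDerivAt (jacEntry σ j k) _ z := h2
    rw [pderiv, h3.fderiv]
    simp
  rw [key, key, (h.isSymmSndFDerivAt (by simp)).eq]

variable [IsManifold (𝓡 2) ∞ M]

/-- With `√det = ε f J` and `det = (f J)²`, the product is the adjugate times `ε / (f J)`. The sign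
`ε` replaces the absolute value, leaving an expression that can be differentiated. -/
lemma sqrtDet_mul_inv {g : Metric M} {Y : CylindricalEnd M} {f : ℝ → ℝ}
    (hg : IsWarpedOnEnd g Y f) (hf : ∀ x, 1 < x → 0 < f x) {c : M} {σ : Plane → Plane} {z : Plane}
    (h : ∀ᶠ w in 𝓝 z, IsCoordChangeAt Y c σ w) {ε : ℝ} (hε : |jac σ z| = ε * jac σ z) :
    (∀ j, sqrtDet g c z * (metricMatrix g c z)⁻¹ 0 j = ε * (f (σ z 0) * jac σ z)⁻¹ *
      ![metricMatrix g c z 1 1, - metricMatrix g c z 0 1] j) ∧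
    (∀ j, sqrtDet g c z * (metricMatrix g c z)⁻¹ 1 j = ε * (f (σ z 0) * jac σ z)⁻¹ *
      ![- metricMatrix g c z 1 0, metricMatrix g c z 0 0] j) := by
  have hz := h.self_of_nhds
  have hF := (hf _ hz.2.2.2.1).ne'
  have hJ := hz.2.2.2.2
  have hdet : (metricMatrix g c z).det = (f (σ z 0) * jac σ z) ^ 2 := by
    rw [Matrix.det_fin_two]
    simp only [metricMatrix_eq hg h, jac]
    ring
  have hinv : ∀ i j, sqrtDet g c z * (metricMatrix g c z)⁻¹ i j =
      ε * (f (σ z 0) * jac σ z)⁻¹ * (metricMatrix g c z).adjugate i j := by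
    intro i j
    rw [Matrix.inv_def, Ring.inverse_eq_inv', hdet, sqrtDet_eq hg hf h, hε, Matrix.smul_apply,
      smul_eq_mul]
    field_simp
  constructor <;> intro j <;> rw [hinv, Matrix.adjugate_fin_two] <;> fin_cases j <;> simp

/-- The flux is a vector density: it transforms by the cofactor matrix of the derivative of `σ`,
applied to the cylinder flux `(f u_x, f⁻¹ u_y)`. The Jacobian in the denominator cancels. -/
lemma flux_eq {g : Metric M} {Y : CylindricalEnd M} {f : ℝ → ℝ}
    (hg : IsWarpedOnEnd g Y f) (hf : ∀ x, 1 < x → 0 < f x) {c : M} {σ : Plane → Plane} {z : Plane}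
    (h : ∀ᶠ w in 𝓝 z, IsCoordChangeAt Y c σ w) {ε : ℝ} (hε : |jac σ z| = ε * jac σ z)
    {u : M → ℂ} (hu : DifferentiableAt ℝ (fun w => u (Y.param w)) (σ z)) :
    flux g c u 0 z = ε * (jacEntry σ 1 1 z * (f (σ z 0) * pderiv 0 (fun w => u (Y.param w)) (σ z)) -
      jacEntry σ 1 0 z * ((f (σ z 0))⁻¹ * pderiv 1 (fun w => u (Y.param w)) (σ z))) ∧
    flux g c u 1 z = ε * (jacEntry σ 0 0 z *
        ((f (σ z 0))⁻¹ * pderiv 1 (fun w => u (Y.param w)) (σ z)) -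
      jacEntry σ 0 1 z * (f (σ z 0) * pderiv 0 (fun w => u (Y.param w)) (σ z))) := by
  have hz := h.self_of_nhds
  have hF : (f (σ z 0) : ℂ) ≠ 0 := by exact_mod_cast (hf _ hz.2.2.2.1).ne'
  have hJ : (jac σ z : ℂ) ≠ 0 := by exact_mod_cast hz.2.2.2.2
  have hd : ∀ j, fderiv ℝ (fun w => u ((chartAt Plane c).symm w)) z (coordVec j) =
      (jacEntry σ j 0 z : ℂ) * pderiv 0 (fun w => u (Y.param w)) (σ z) +
        (jacEntry σ j 1 z : ℂ) * pderiv 1 (fun w => u (Y.param w)) (σ z) := by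
    intro j
    have h1 : (fun w => u ((chartAt Plane c).symm w)) =ᶠ[𝓝 z] fun w => u (Y.param (σ w)) :=
      h.mono fun w hw => by simp only [hw.2.1]
    rw [h1.fderiv_eq]
    exact pderiv_comp (v := fun w => u (Y.param w)) hu (hz.1.differentiableAt (by simp)) j
  obtain ⟨h0, h1⟩ := sqrtDet_mul_inv hg hf h hε
  have hJ' : (jac σ z : ℂ) = jacEntry σ 0 0 z * jacEntry σ 1 1 z -
      jacEntry σ 1 0 z * jacEntry σ 0 1 z := by
    rw [jac]; push_cast; rfl
  constructor
  · rw [flux, Fin.sum_univ_two, hd, hd, h0, h0]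
    simp only [metricMatrix_eq hg h, Matrix.cons_val_zero, Matrix.cons_val_one]
    push_cast
    field_simp
    rw [hJ']
    ring
  · rw [flux, Fin.sum_univ_two, hd, hd, h1, h1]
    simp only [metricMatrix_eq hg h, Matrix.cons_val_zero, Matrix.cons_val_one]
    push_cast
    field_simp
    rw [hJ']
    ring

lemma pderiv_ofReal_mul {a : Plane → ℝ} {v : Plane → ℂ} {z : Plane}
    (ha : DifferentiableAt ℝ a z) (hv : DifferentiableAt ℝ v z) (i : Fin 2) :
    DifferentiableAt ℝ (fun w => (a w : ℂ) * v w) z ∧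
    pderiv i (fun w => (a w : ℂ) * v w) z =
      (a z : ℂ) * pderiv i v z + ((pderiv i a z : ℝ) : ℂ) * v z := by
  simp only [← Complex.real_smul]
  have h1 : HasFDerivAt (fun w => a w • v w) _ z := ha.hasFDerivAt.smul hv.hasFDerivAt
  refine ⟨h1.differentiableAt, ?_⟩
  rw [pderiv, h1.fderiv]
  simp [pderiv]

lemma pderiv_comp_coord {F : ℝ → ℝ} {w : Plane} (hF : DifferentiableAt ℝ F (w 0)) :
    DifferentiableAt ℝ (fun w : Plane => F (w 0)) w ∧
    pderiv 0 (fun w : Plane => F (w 0)) w = deriv F (w 0) ∧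
    pderiv 1 (fun w : Plane => F (w 0)) w = 0 := by
  have h1 := hF.hasDerivAt.comp_hasFDerivAt w
    ((EuclideanSpace.proj (𝕜 := ℝ) (0 : Fin 2) : Plane →L[ℝ] ℝ).hasFDerivAt)
  have h2 : HasFDerivAt (fun w : Plane => F (w 0)) _ w := h1
  refine ⟨h2.differentiableAt, ?_, ?_⟩ <;> rw [pderiv, h2.fderiv] <;> simp [coordVec]

/-- The Laplacian of a metric that is a warped product on the end, in cylinder coordinates. -/
theorem laplacian_eq_warpedLaplacian_of_chart {g : Metric M} {Y : CylindricalEnd M} {f : ℝ → ℝ}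
    (hg : IsWarpedOnEnd g Y f) (hf : ∀ x, 1 < x → 0 < f x)
    (hf' : ∀ x, 1 < x → DifferentiableAt ℝ f x) {u : M → ℂ}
    (hu : ∀ w : Plane, 1 < w 0 → ContDiffAt ℝ 2 (fun w => u (Y.param w)) w)
    {c : M} {σ : Plane → Plane} {z : Plane}
    (h : ∀ᶠ w in 𝓝 z, IsCoordChangeAt Y c σ w) :
    ((sqrtDet g c z)⁻¹ : ℂ) * ∑ i, fderiv ℝ (flux g c u i) z (coordVec i) =
      warpedLaplacian f (fun w => u (Y.param w)) (σ z) := by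
  have hz := h.self_of_nhds
  have hx := hz.2.2.2.1
  have hF := (hf _ hx).ne'
  have hJ := hz.2.2.2.2
  -- The Jacobian is continuous and nonzero at `z`, so its sign is constant nearby.
  obtain ⟨ε, hε2, hε⟩ : ∃ ε : ℝ, ε ^ 2 = 1 ∧ ∀ᶠ w in 𝓝 z, |jac σ w| = ε * jac σ w := by
    rcases lt_or_gt_of_ne hJ with hneg | hpos
    · refine ⟨-1, by norm_num, ?_⟩
      filter_upwards [(continuousAt_jac hz.1).eventually_lt_const hneg] with w hw
      rw [abs_of_neg hw]; ring
    · refine ⟨1, by norm_num, ?_⟩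
      filter_upwards [(continuousAt_jac hz.1).eventually_const_lt hpos] with w hw
      rw [abs_of_pos hw]; ring
  set v : Plane → ℂ := fun w => u (Y.param w) with hv
  set P : Plane → ℂ := fun w => (f (w 0) : ℂ) * pderiv 0 v w with hP
  set Q : Plane → ℂ := fun w => (((f (w 0))⁻¹ : ℝ) : ℂ) * pderiv 1 v w with hQ
  have hvd := fun i => (contDiffAt_pderiv (hu _ hx) i).differentiableAt (by simp)
  have hfd := pderiv_comp_coord (hf' _ hx)
  have hfid := pderiv_comp_coord (F := fun x => (f x)⁻¹) ((hf' _ hx).inv hF)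
  have hPd := fun i => pderiv_ofReal_mul hfd.1 (hvd 0) i
  have hQd := fun i => pderiv_ofReal_mul hfid.1 (hvd 1) i
  have hσd : DifferentiableAt ℝ σ z := hz.1.differentiableAt (by simp)
  have hPσ : DifferentiableAt ℝ (fun w => P (σ w)) z := (hPd 0).1.comp z hσd
  have hQσ : DifferentiableAt ℝ (fun w => Q (σ w)) z := (hQd 0).1.comp z hσd
  have hj := fun i k => (contDiffAt_jacEntry hz.1 i k).differentiableAt (by simp)
  have hflux : (flux g c u 0 =ᶠ[𝓝 z] fun w => (ε : ℂ) * (((jacEntry σ 1 1 w : ℝ) : ℂ) * P (σ w) -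
        ((jacEntry σ 1 0 w : ℝ) : ℂ) * Q (σ w))) ∧
      (flux g c u 1 =ᶠ[𝓝 z] fun w => (ε : ℂ) * (((jacEntry σ 0 0 w : ℝ) : ℂ) * Q (σ w) -
        ((jacEntry σ 0 1 w : ℝ) : ℂ) * P (σ w))) := by
    constructor <;> filter_upwards [h.eventually_nhds, hε] with w hw hεw
    · simpa [hP, hQ, hv] using
        (flux_eq hg hf hw hεw ((hu _ hw.self_of_nhds.2.2.2.1).differentiableAt (by simp))).1
    · simpa [hP, hQ, hv] using
        (flux_eq hg hf hw hεw ((hu _ hw.self_of_nhds.2.2.2.1).differentiableAt (by simp))).2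
  have hdiff : ∀ {A B : Plane → ℂ} (_ : DifferentiableAt ℝ A z) (_ : DifferentiableAt ℝ B z)
      (i : Fin 2), fderiv ℝ (fun w => (ε : ℂ) * (A w - B w)) z (coordVec i) =
        (ε : ℂ) * (pderiv i A z - pderiv i B z) := by
    intro A B hA hB i
    have := (hA.hasFDerivAt.sub hB.hasFDerivAt).const_mul (ε : ℂ)
    have h' : HasFDerivAt (fun w => (ε : ℂ) * (A w - B w)) _ z := this
    rw [h'.fderiv]
    simp [pderiv]
  have d11 := fun i => pderiv_ofReal_mul (hj 1 1) hPσ i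
  have d10 := fun i => pderiv_ofReal_mul (hj 1 0) hQσ i
  have d00 := fun i => pderiv_ofReal_mul (hj 0 0) hQσ i
  have d01 := fun i => pderiv_ofReal_mul (hj 0 1) hPσ i
  -- By symmetry of second derivatives the cofactor matrix is divergence free, so only the chain
  -- rule terms survive: the divergence is `ε J (∂₀ P + ∂₁ Q)` at `σ z`.
  rw [Fin.sum_univ_two, hflux.1.fderiv_eq, hflux.2.fderiv_eq, hdiff (d11 0).1 (d10 0).1,
    hdiff (d00 1).1 (d01 1).1, (d11 0).2, (d10 0).2, (d00 1).2, (d01 1).2,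
    pderiv_comp (hPd 0).1 hσd, pderiv_comp (hQd 0).1 hσd,
    pderiv_comp (hQd 0).1 hσd, pderiv_comp (hPd 0).1 hσd,
    pderiv_jacEntry_comm hz.1 0 1 1, pderiv_jacEntry_comm hz.1 0 1 0]
  have hP0 : pderiv 0 P (σ z) = _ := (hPd 0).2
  have hQ1 : pderiv 1 Q (σ z) = _ := (hQd 1).2
  rw [hfd.2.1] at hP0
  rw [hfid.2.2] at hQ1
  have hsq : sqrtDet g c z = f (σ z 0) * (ε * jac σ z) := by
    rw [sqrtDet_eq hg hf h, hε.self_of_nhds]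
  have hεC : (ε : ℂ) ≠ 0 := by
    have : ε ≠ 0 := by rintro rfl; norm_num at hε2
    exact_mod_cast this
  have hFC : (f (σ z 0) : ℂ) ≠ 0 := by exact_mod_cast hF
  have hJC : (jac σ z : ℂ) ≠ 0 := by exact_mod_cast hJ
  have hJ' : (jac σ z : ℂ) = jacEntry σ 0 0 z * jacEntry σ 1 1 z -
      jacEntry σ 1 0 z * jacEntry σ 0 1 z := by
    rw [jac]; push_cast; rfl
  have main : (ε : ℂ) * (jac σ z * (pderiv 0 P (σ z) + pderiv 1 Q (σ z))) =
      (f (σ z 0) * (ε * jac σ z)) * warpedLaplacian f v (σ z) := by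
    rw [hP0, hQ1, warpedLaplacian]
    push_cast
    field_simp
    ring
  rw [hsq, Complex.ofReal_mul, Complex.ofReal_mul,
    inv_mul_eq_iff_eq_mul₀ (by simp [hεC, hFC, hJC]), ← main, hJ']
  simp only [hP, hQ]
  ring

end ChartComputation

/-! ### Laplacian and Riemannian measure on the open end -/

section LaplacianOnEnd

variable {M : Type*} [TopologicalSpace M] [ChartedSpace Plane M]

lemma contDiffAt_comp_param (Y : CylindricalEnd M) {u : M → ℂ}
    (hu : ContMDiff (𝓡 2) 𝓘(ℝ, ℂ) ∞ u) {w : Plane} (hw : 1 < w 0) :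
    ContDiffAt ℝ 2 (fun w => u (Y.param w)) w := by
  have h : ContMDiffAt (𝓡 2) 𝓘(ℝ, ℂ) ∞ (fun w => u (Y.param w)) w :=
    hu.contMDiffAt.comp w (Y.contMDiffAt_param (by linarith [Y.collar_pos]))
  exact h.contDiffAt.of_le (by norm_cast)

lemma continuousAt_warpedLaplacian {f : ℝ → ℝ} {u : Plane → ℂ} {w : Plane}
    (hf : f (w 0) ≠ 0) (hf' : ContDiffAt ℝ 2 f (w 0)) (hu : ContDiffAt ℝ 2 u w) :
    ContinuousAt (warpedLaplacian f u) w := by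
  have hx : ContinuousAt (fun w : Plane => w 0) w :=
    (EuclideanSpace.proj (𝕜 := ℝ) (0 : Fin 2)).continuous.continuousAt
  have h1 : ContinuousAt (fun w : Plane => f (w 0)) w :=
    ContinuousAt.comp (f := fun w : Plane => w 0) hf'.continuousAt hx
  have h2 : ContinuousAt (fun w : Plane => deriv f (w 0)) w :=
    ContinuousAt.comp (f := fun w : Plane => w 0)
      ((hf'.fderiv_right (m := 1) (by norm_num)).continuousAt.clm_apply continuousAt_const) hx
  have h3 := (contDiffAt_pderiv hu 0).continuousAt
  have h4 := continuousAt_pderiv_pderiv hu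
  have h5 : ContinuousAt (fun w : Plane => ((deriv f (w 0) / f (w 0) : ℝ) : ℂ)) w :=
    Complex.continuous_ofReal.continuousAt.comp (h2.div h1 hf)
  have h6 : ContinuousAt (fun w : Plane => (((f (w 0))⁻¹ ^ 2 : ℝ) : ℂ)) w :=
    Complex.continuous_ofReal.continuousAt.comp ((h1.inv₀ hf).pow 2)
  exact ((h4 0 0).add (h5.mul h3)).add (h6.mul (h4 1 1))

variable [IsManifold (𝓡 2) ∞ M]

/-- Near a point of the open end, the parametrization has a section that is continuous there. -/
lemma CylindricalEnd.exists_local_section {Y : CylindricalEnd M} {q : Plane} (hq : 1 < q 0) :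
    ∃ ρ : M → Plane, ρ (Y.param q) = q ∧ ContinuousAt ρ (Y.param q) ∧
      ∀ᶠ p in 𝓝 (Y.param q), 1 < ρ p 0 ∧ Y.param (ρ p) = p := by
  obtain ⟨σ, hσ, h⟩ := Y.exists_coordChange hq (mem_chart_source Plane (Y.param q))
  have hc : ContinuousAt (chartAt Plane (Y.param q)) (Y.param q) :=
    (chartAt Plane (Y.param q)).continuousAt (mem_chart_source Plane _)
  refine ⟨fun p => σ (chartAt Plane (Y.param q) p), hσ,
    ContinuousAt.comp h.self_of_nhds.1.continuousAt hc, ?_⟩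
  filter_upwards [hc.eventually h, (chartAt Plane (Y.param q)).open_source.mem_nhds
    (mem_chart_source Plane _)] with p hp hs
  refine ⟨hp.2.2.2.1, ?_⟩
  rw [hp.2.1]
  exact (chartAt Plane (Y.param q)).left_inv hs

/-- The Laplacian at `p` is computed in the chart at `p`, which need not vary continuously with `p`;
this transfers continuity from cylinder coordinates instead. -/
lemma CylindricalEnd.continuousAt_of_comp_param (Y : CylindricalEnd M) {H : M → ℂ} {h : Plane → ℂ}
    (hH : ∀ q : Plane, 1 < q 0 → H (Y.param q) = h q) {q : Plane} (hq : 1 < q 0)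
    (hc : ContinuousAt h q) : ContinuousAt H (Y.param q) := by
  obtain ⟨ρ, hρ, hρc, he⟩ := Y.exists_local_section hq
  have h1 : H =ᶠ[𝓝 (Y.param q)] fun p => h (ρ p) := by
    filter_upwards [he] with p hp
    rw [← hH _ hp.1, hp.2]
  refine ContinuousAt.congr ?_ h1.symm
  apply ContinuousAt.comp _ hρc
  rwa [hρ]

/-- A compact subset of the open end is covered by a compact set of cylinder coordinates. -/
lemma CylindricalEnd.exists_isCompact_subset_image (Y : CylindricalEnd M) {K : Set M}
    (hK : IsCompact K) (hKY : K ⊆ Y.openEnd) :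
    ∃ B : Set Plane, IsCompact B ∧ (∀ q ∈ B, 1 < q 0) ∧ K ⊆ Y.param '' B := by
  have hopen : IsOpen {q : Plane | 1 < q 0} := isOpen_lt continuous_const (by fun_prop)
  refine hK.induction_on (p := fun K => ∃ B : Set Plane, IsCompact B ∧ (∀ q ∈ B, 1 < q 0) ∧
    K ⊆ Y.param '' B) ⟨∅, isCompact_empty, by simp, by simp⟩ ?_ ?_ ?_
  · rintro s t hst ⟨B, h1, h2, h3⟩
    exact ⟨B, h1, h2, hst.trans h3⟩
  · rintro s t ⟨B, h1, h2, h3⟩ ⟨C, k1, k2, k3⟩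
    refine ⟨B ∪ C, h1.union k1, ?_, ?_⟩
    · rintro q (hq | hq)
      exacts [h2 q hq, k2 q hq]
    · rw [image_union]
      exact union_subset_union h3 k3
  · intro p hp
    obtain ⟨q, hq, rfl⟩ := hKY hp
    obtain ⟨B, hB, hqB, hBs⟩ := exists_compact_subset hopen hq
    obtain ⟨ρ, hρ, hρc, he⟩ := Y.exists_local_section hq
    refine ⟨Y.param '' B, mem_nhdsWithin_of_mem_nhds ?_, B, hB, fun q hq => hBs hq, subset_rfl⟩
    have h1 : ∀ᶠ p in 𝓝 (Y.param q), ρ p ∈ B :=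
      hρc (by rw [hρ]; exact mem_interior_iff_mem_nhds.1 hqB)
    filter_upwards [he, h1] with p h2 h3
    exact ⟨ρ p, h3, h2.2⟩

/-- The Laplacian of a metric that is a warped product on the end, in cylinder coordinates. -/
theorem laplacian_param {g : Metric M} {Y : CylindricalEnd M} {f : ℝ → ℝ}
    (hg : IsWarpedOnEnd g Y f) (hf : ∀ x, 1 < x → 0 < f x)
    (hf' : ∀ x, 1 < x → ContDiffAt ℝ 2 f x) {u : M → ℂ}
    (hu : ContMDiff (𝓡 2) 𝓘(ℝ, ℂ) ∞ u) {q : Plane} (hq : 1 < q 0) :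
    laplacian g u (Y.param q) = warpedLaplacian f (fun w => u (Y.param w)) q := by
  obtain ⟨σ, hσ, h⟩ := Y.exists_coordChange hq (mem_chart_source Plane (Y.param q))
  have := laplacian_eq_warpedLaplacian_of_chart hg hf
    (fun x hx => (hf' x hx).differentiableAt (by simp))
    (fun w hw => contDiffAt_comp_param Y hu hw) h
  rw [hσ] at this
  exact this

lemma laplacian_eq_zero (g : Metric M) {u : M → ℂ} {p : M} (hp : p ∉ tsupport u) :
    laplacian g u p = 0 := by
  have hs := (chartAt Plane p).map_source (mem_chart_source Plane p)
  have hc : ContinuousAt (chartAt Plane p).symm (chartAt Plane p p) :=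
    (chartAt Plane p).continuousAt_symm hs
  have h1 : ∀ᶠ z in 𝓝 (chartAt Plane p p), u ((chartAt Plane p).symm z) = 0 := by
    refine hc.eventually (p := fun y => u y = 0) ?_
    rw [(chartAt Plane p).left_inv (mem_chart_source Plane p)]
    filter_upwards [(isClosed_tsupport u).isOpen_compl.mem_nhds hp] with y hy
    exact image_eq_zero_of_notMem_tsupport hy
  have h2 : ∀ i, flux g p u i =ᶠ[𝓝 (chartAt Plane p p)] fun _ => 0 := by
    intro i
    filter_upwards [h1.eventually_nhds] with z hz
    have h3 : (fun w => u ((chartAt Plane p).symm w)) =ᶠ[𝓝 z] fun _ => (0 : ℂ) := hz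
    simp [flux, h3.fderiv_eq]
  simp [laplacian, (h2 _).fderiv_eq]

lemma continuous_laplacian {g : Metric M} {Y : CylindricalEnd M} {f : ℝ → ℝ}
    (hg : IsWarpedOnEnd g Y f) (hf : ∀ x, 1 < x → 0 < f x)
    (hf' : ∀ x, 1 < x → ContDiffAt ℝ 2 f x) {u : M → ℂ}
    (hu : ContMDiff (𝓡 2) 𝓘(ℝ, ℂ) ∞ u) (huY : tsupport u ⊆ Y.openEnd) :
    Continuous (laplacian g u) := by
  rw [continuous_iff_continuousAt]
  intro p
  by_cases hp : p ∈ tsupport u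
  · obtain ⟨q, hq, rfl⟩ := huY hp
    exact Y.continuousAt_of_comp_param (fun q hq => laplacian_param hg hf hf' hu hq) hq
      (continuousAt_warpedLaplacian (hf _ hq).ne' (hf' _ hq) (contDiffAt_comp_param Y hu hq))
  · have h1 : laplacian g u =ᶠ[𝓝 p] fun _ => 0 := by
      filter_upwards [(isClosed_tsupport u).isOpen_compl.mem_nhds hp] with y hy
      exact laplacian_eq_zero g hy
    exact continuousAt_const.congr h1.symm

lemma continuousAt_sqrtDet {g : Metric M} {Y : CylindricalEnd M} {f : ℝ → ℝ}
    (hg : IsWarpedOnEnd g Y f) (hf : ∀ x, 1 < x → 0 < f x)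
    (hf' : ∀ x, 1 < x → ContDiffAt ℝ 2 f x) {c p : M} (hp : p ∈ Y.openEnd)
    (hc : p ∈ (chartAt Plane c).source) : ContinuousAt (sqrtDet g c) (chartAt Plane c p) := by
  obtain ⟨q, hq, rfl⟩ := hp
  obtain ⟨σ, hσ, h⟩ := Y.exists_coordChange hq hc
  have hz := h.self_of_nhds
  have h1 : sqrtDet g c =ᶠ[𝓝 (chartAt Plane c (Y.param q))] fun z => f (σ z 0) * |jac σ z| :=
    h.eventually_nhds.mono fun z hz => sqrtDet_eq hg hf hz
  refine ContinuousAt.congr ?_ h1.symm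
  have h2 : ContinuousAt (fun z => σ z 0) (chartAt Plane c (Y.param q)) :=
    (EuclideanSpace.proj (𝕜 := ℝ) (0 : Fin 2)).continuous.continuousAt.comp hz.1.continuousAt
  exact (ContinuousAt.comp (f := fun z => σ z 0) (hf' _ hz.2.2.2.1).continuousAt h2).mul
    (continuousAt_jac hz.1).abs

variable [T2Space M] [MeasurableSpace M] [BorelSpace M]

lemma chartMeasure_lt_top {g : Metric M} {c : M} {K : Set M} (hK : IsCompact K)
    (hKc : K ⊆ (chartAt Plane c).source)
    (hcont : ∀ p ∈ K, ContinuousAt (sqrtDet g c) (chartAt Plane c p)) :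
    chartMeasure g c K < ⊤ := by
  have hKm : MeasurableSet K := hK.isClosed.measurableSet
  -- Without a.e. measurability `Measure.map` is zero by convention, and the bound is trivial.
  by_cases hm : AEMeasurable (chartAt Plane c).symm
    ((volume.restrict (chartAt Plane c).target).withDensity
      fun z => ENNReal.ofReal (sqrtDet g c z))
  swap
  · simp [chartMeasure, Measure.map_of_not_aemeasurable hm]
  set L := chartAt Plane c '' K with hL
  have hLc : IsCompact L := hK.image_of_continuousOn ((chartAt Plane c).continuousOn.mono hKc)
  have hLm : MeasurableSet L := hLc.isClosed.measurableSet
  obtain ⟨C, hC⟩ : ∃ C, ∀ z ∈ L, sqrtDet g c z ≤ C := by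
    have : ContinuousOn (sqrtDet g c) L := by
      rintro _ ⟨p, hp, rfl⟩
      exact (hcont p hp).continuousWithinAt
    obtain ⟨C, hC⟩ := hLc.exists_bound_of_continuousOn this
    exact ⟨C, fun z hz => (le_abs_self _).trans (hC z hz)⟩
  set T := (chartAt Plane c).target
  have hTm : MeasurableSet T := (chartAt Plane c).open_target.measurableSet
  set ν := (volume.restrict T).withDensity fun z => ENNReal.ofReal (sqrtDet g c z) with hν
  -- Outside the target the inverse chart has junk values that may fall in `K`; that region is null.
  have hνT : ν Tᶜ = 0 := by
    rw [hν, withDensity_apply _ hTm.compl, Measure.restrict_restrict hTm.compl]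
    simp
  calc chartMeasure g c K = ν ((chartAt Plane c).symm ⁻¹' K) :=
        Measure.map_apply_of_aemeasurable hm hKm
    _ ≤ ν (L ∪ Tᶜ) := by
      refine measure_mono fun z hz => ?_
      by_cases hzT : z ∈ T
      · exact Or.inl ⟨_, hz, (chartAt Plane c).right_inv hzT⟩
      · exact Or.inr hzT
    _ ≤ ν L + ν Tᶜ := measure_union_le _ _
    _ = ∫⁻ z in L, ENNReal.ofReal (sqrtDet g c z) ∂(volume.restrict T) := by
      rw [hνT, add_zero, hν, withDensity_apply _ hLm]
    _ ≤ ∫⁻ z in L, ENNReal.ofReal C ∂(volume.restrict T) :=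
      setLIntegral_mono' hLm fun z hz => ENNReal.ofReal_le_ofReal (hC z hz)
    _ ≤ ENNReal.ofReal C * volume L := by
      rw [setLIntegral_const]
      gcongr
      exact Measure.restrict_le_self
    _ < ⊤ := ENNReal.mul_lt_top ENNReal.ofReal_lt_top hLc.measure_lt_top

variable [SigmaCompactSpace M]

/-- Compact subsets of the open end have finite Riemannian measure. -/
theorem riemannianMeasure_lt_top {g : Metric M} {Y : CylindricalEnd M} {f : ℝ → ℝ}
    (hg : IsWarpedOnEnd g Y f) (hf : ∀ x, 1 < x → 0 < f x)
    (hf' : ∀ x, 1 < x → ContDiffAt ℝ 2 f x) {K : Set M} (hK : IsCompact K)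
    (hKY : K ⊆ Y.openEnd) : riemannianMeasure g K < ⊤ := by
  have hKm : MeasurableSet K := hK.isClosed.measurableSet
  have hsub : (chartPartition M).IsSubordinate fun c => (chartAt Plane c).source :=
    (SmoothPartitionOfUnity.exists_isSubordinate_chartAt_source (𝓡 2) M).choose_spec
  have hterm : ∀ c : M, (chartMeasure g c).withDensity
      (fun p => ENNReal.ofReal (chartPartition M c p)) K ≤
        chartMeasure g c (K ∩ tsupport (chartPartition M c)) := by
    intro c
    rw [withDensity_apply _ hKm]
    calc ∫⁻ p in K, ENNReal.ofReal (chartPartition M c p) ∂(chartMeasure g c)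
        ≤ ∫⁻ p in K, (tsupport (chartPartition M c)).indicator 1 p ∂(chartMeasure g c) := by
          refine lintegral_mono fun p => ?_
          by_cases hp : p ∈ tsupport (chartPartition M c)
          · simpa [indicator_of_mem hp] using (chartPartition M).le_one c p
          · simp [image_eq_zero_of_notMem_tsupport hp]
      _ = chartMeasure g c (K ∩ tsupport (chartPartition M c)) := by
          rw [lintegral_indicator_one (isClosed_tsupport _).measurableSet,
            Measure.restrict_apply (isClosed_tsupport _).measurableSet, inter_comm]
  -- Local finiteness leaves only finitely many charts whose partition function has support meeting
  -- `K`.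
  have hfin := (chartPartition M).locallyFinite.closure.finite_nonempty_inter_compact hK
  rw [riemannianMeasure, Measure.sum_apply _ hKm, tsum_eq_sum (s := hfin.toFinset)]
  · refine ENNReal.sum_lt_top.2 fun c _ => (hterm c).trans_lt ?_
    refine chartMeasure_lt_top (hK.inter_right (isClosed_tsupport _))
      (inter_subset_right.trans (hsub c)) fun p hp => ?_
    exact continuousAt_sqrtDet hg hf hf' (hKY hp.1) (hsub c hp.2)
  · intro c hc
    have h0 : K ∩ tsupport (chartPartition M c) = ∅ := by
      rw [inter_comm, ← not_nonempty_iff_eq_empty]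
      intro hne
      exact hc (hfin.mem_toFinset.2 hne)
    refine le_antisymm ((hterm c).trans ?_) zero_le
    rw [h0, measure_empty]

end LaplacianOnEnd

/-! ### The power profile and its exponential limit -/

lemma powerProfile_base_pos {a x : ℝ} (ha : 0 < a) (hx : 1 < x) : 0 < 1 + x / a := by
  have : 0 < x / a := div_pos (by linarith) ha
  linarith

lemma contDiffAt_powerProfile {a x : ℝ} (ha : 0 < a) (hx : 1 < x) :
    ContDiffAt ℝ 2 (fun x : ℝ => (1 + x / a) ^ (-a)) x :=
  ContDiffAt.rpow_const_of_ne (by fun_prop) (powerProfile_base_pos ha hx).ne'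

lemma deriv_powerProfile_div {a x : ℝ} (ha : 0 < a) (hx : 1 < x) :
    deriv (fun x : ℝ => (1 + x / a) ^ (-a)) x / (1 + x / a) ^ (-a) = -(1 + x / a)⁻¹ := by
  have hb := powerProfile_base_pos ha hx
  have h1 : HasDerivAt (fun x : ℝ => 1 + x / a) (1 / a) x :=
    ((hasDerivAt_id x).div_const a).const_add 1
  rw [(h1.rpow_const (Or.inl hb.ne')).deriv, Real.rpow_sub_one hb.ne']
  have := (Real.rpow_pos_of_pos hb (-a)).ne'
  field_simp

lemma powerProfile_inv {a x : ℝ} (ha : 0 < a) (hx : 1 < x) :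
    ((1 + x / a) ^ (-a))⁻¹ = (1 + x / a) ^ a := by
  rw [Real.rpow_neg (powerProfile_base_pos ha hx).le, inv_inv]

lemma one_add_div_rpow_le_exp {a x : ℝ} (ha : 0 < a) (hx : 1 < x) :
    (1 + x / a) ^ a ≤ Real.exp x := by
  have h1 : 1 + x / a ≤ Real.exp (x / a) := by
    rw [add_comm]; exact Real.add_one_le_exp _
  calc (1 + x / a) ^ a ≤ Real.exp (x / a) ^ a :=
        Real.rpow_le_rpow (powerProfile_base_pos ha hx).le h1 ha.le
    _ = Real.exp x := by rw [← Real.exp_mul, div_mul_cancel₀ _ ha.ne']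

/-- The second `x`-derivatives cancel, and the logarithmic derivatives of the two profiles are `-(1
+ x/a)⁻¹` and `-1`. -/
lemma warpedLaplacian_sub {a : ℝ} (ha : 0 < a) (u : Plane → ℂ) {q : Plane} (hq : 1 < q 0) :
    warpedLaplacian (fun x => (1 + x / a) ^ (-a)) u q -
        warpedLaplacian (fun x => Real.exp (-x)) u q =
      ((1 - (1 + q 0 / a)⁻¹ : ℝ) : ℂ) * pderiv 0 u q +
        ((((1 + q 0 / a) ^ a) ^ 2 - Real.exp (q 0) ^ 2 : ℝ) : ℂ) * pderiv 1 (pderiv 1 u) q := by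
  have h2 : deriv (fun x : ℝ => Real.exp (-x)) (q 0) / Real.exp (-(q 0)) = -1 := by
    rw [((hasDerivAt_neg (q 0)).exp).deriv]
    field_simp
  simp only [warpedLaplacian]
  rw [deriv_powerProfile_div ha hq, powerProfile_inv ha hq, h2, Real.exp_neg, inv_inv]
  push_cast
  ring

/-- The bound does not depend on `a`, as domination requires: both `(1 + x/a)⁻¹` and `(1 + x/a)^a
e^(-x)` lie between `0` and `1`. -/
lemma norm_warpedLaplacian_sub_le {a : ℝ} (ha : 0 < a) (u : Plane → ℂ) {q : Plane}
    (hq : 1 < q 0) :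
    ‖warpedLaplacian (fun x => (1 + x / a) ^ (-a)) u q -
        warpedLaplacian (fun x => Real.exp (-x)) u q‖ ≤
      ‖pderiv 0 u q‖ + Real.exp (q 0) ^ 2 * ‖pderiv 1 (pderiv 1 u) q‖ := by
  rw [warpedLaplacian_sub ha u hq]
  have hb := powerProfile_base_pos ha hq
  have hb1 : (1 + q 0 / a)⁻¹ ≤ 1 :=
    inv_le_one_of_one_le₀ (by linarith [div_pos (zero_lt_one.trans hq) ha])
  have h1 : |1 - (1 + q 0 / a)⁻¹| ≤ 1 := by
    rw [abs_le]
    constructor <;> linarith [inv_pos.2 hb]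
  have hp := Real.rpow_pos_of_pos hb a
  have hle := one_add_div_rpow_le_exp ha hq
  have h2 : |((1 + q 0 / a) ^ a) ^ 2 - Real.exp (q 0) ^ 2| ≤ Real.exp (q 0) ^ 2 := by
    have : ((1 + q 0 / a) ^ a) ^ 2 ≤ Real.exp (q 0) ^ 2 := by gcongr
    rw [abs_le]
    constructor <;> nlinarith [sq_nonneg ((1 + q 0 / a) ^ a)]
  refine (norm_add_le _ _).trans ?_
  rw [norm_mul, norm_mul, Complex.norm_real, Complex.norm_real, Real.norm_eq_abs, Real.norm_eq_abs]
  gcongr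
  exact mul_le_of_le_one_left (norm_nonneg _) h1

lemma tendsto_warpedLaplacian_sub (u : Plane → ℂ) {q : Plane} (hq : 1 < q 0) :
    Tendsto (fun a : ℝ => warpedLaplacian (fun x => (1 + x / a) ^ (-a)) u q -
        warpedLaplacian (fun x => Real.exp (-x)) u q) atTop (𝓝 0) := by
  have h1 : Tendsto (fun a : ℝ => 1 - (1 + q 0 / a)⁻¹) atTop (𝓝 0) := by
    have h : Tendsto (fun a : ℝ => q 0 / a) atTop (𝓝 0) := tendsto_const_nhds.div_atTop tendsto_id
    have := ((h.const_add 1).inv₀ (by norm_num)).const_sub 1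
    simpa using this
  have h2 : Tendsto (fun a : ℝ => ((1 + q 0 / a) ^ a) ^ 2 - Real.exp (q 0) ^ 2) atTop (𝓝 0) := by
    have := ((Real.tendsto_one_add_div_rpow_exp (q 0)).pow 2).sub_const (Real.exp (q 0) ^ 2)
    simpa using this
  have h3 := (((Complex.continuous_ofReal.tendsto 0).comp h1).mul_const (pderiv 0 u q)).add
    (((Complex.continuous_ofReal.tendsto 0).comp h2).mul_const (pderiv 1 (pderiv 1 u) q))
  simp only [Complex.ofReal_zero, zero_mul, add_zero] at h3
  refine h3.congr' ?_
  filter_upwards [eventually_gt_atTop 0] with a ha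
  exact (warpedLaplacian_sub ha u hq).symm

/-! ### Square integrability and dominated convergence on a compact support -/

section Lp

variable {X : Type*} [MeasurableSpace X] [TopologicalSpace X] [OpensMeasurableSpace X]
  {μ : Measure X} {K : Set X}

lemma memLp_two_of_continuous_of_support_subset [T2Space X] {F : X → ℂ} (hF : Continuous F)
    (hK : IsCompact K) (hμ : μ K < ⊤) (h0 : ∀ p ∉ K, F p = 0) : MemLp F 2 μ := by
  obtain ⟨C, hC⟩ := hK.exists_bound_of_continuousOn hF.continuousOn
  have hKm : MeasurableSet K := hK.isClosed.measurableSet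
  have hi : K.indicator F = F := indicator_eq_self.2 fun p hp => by
    by_contra h
    exact hp (h0 p h)
  rw [← hi, memLp_indicator_iff_restrict hKm]
  have : IsFiniteMeasure (μ.restrict K) := ⟨by simpa using hμ⟩
  exact MemLp.of_bound hF.measurable.aestronglyMeasurable C (ae_restrict_of_forall_mem hKm hC)

lemma tendsto_norm_toLp_zero {ι : Type*} {l : Filter ι} [l.IsCountablyGenerated] {F : ι → X → ℂ}
    (hF : ∀ i, Continuous (F i)) (hK : MeasurableSet K) (hμ : μ K < ⊤)
    (h0 : ∀ i, ∀ p ∉ K, F i p = 0) {C : ℝ} (hC : ∀ i, ∀ p ∈ K, ‖F i p‖ ≤ C)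
    (hlim : ∀ p ∈ K, Tendsto (fun i => F i p) l (𝓝 0)) (hm : ∀ i, MemLp (F i) 2 μ) :
    Tendsto (fun i => ‖(hm i).toLp (F i)‖) l (𝓝 0) := by
  -- The dominating function is the constant `C²` on `K`, integrable because `K` has finite measure.
  have key : Tendsto (fun i => ∫⁻ p, ‖F i p‖ₑ ^ (2 : ℝ) ∂μ) l (𝓝 (∫⁻ _, 0 ∂μ)) := by
    refine tendsto_lintegral_filter_of_dominated_convergence
      (K.indicator fun _ => ENNReal.ofReal C ^ (2 : ℝ)) ?_ ?_ ?_ ?_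
    · exact .of_forall fun i => ((hF i).measurable.enorm).pow_const _
    · refine .of_forall fun i => .of_forall fun p => ?_
      by_cases hp : p ∈ K
      · rw [indicator_of_mem hp, ← ofReal_norm]
        gcongr
        exact hC i p hp
      · simp [h0 i p hp]
    · rw [lintegral_indicator hK, setLIntegral_const]
      exact (ENNReal.mul_lt_top (by simp) hμ).ne
    · refine .of_forall fun p => ?_
      by_cases hp : p ∈ K
      · have := (hlim p hp).enorm.ennrpow_const (2 : ℝ)
        simpa using this
      · simpa [h0 _ p hp] using tendsto_const_nhds
  rw [lintegral_zero] at key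
  have h1 : ∀ i, eLpNorm (F i) 2 μ = (∫⁻ p, ‖F i p‖ₑ ^ (2 : ℝ) ∂μ) ^ (1 / 2 : ℝ) := by
    intro i
    rw [eLpNorm_eq_lintegral_rpow_enorm_toReal (by norm_num) (by norm_num)]
    simp
  have h2 : Tendsto (fun i => eLpNorm (F i) 2 μ) l (𝓝 0) := by
    simp only [h1]
    have := key.ennrpow_const (1 / 2 : ℝ)
    simpa using this
  simp only [Lp.norm_toLp]
  exact (ENNReal.tendsto_toReal ENNReal.zero_ne_top).comp h2

end Lp

lemma isResolventAt_resolventOf {H : Type*} [NormedAddCommGroup H] [NormedSpace ℂ H]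
    {T : Submodule ℂ (H × H)} {lam : ℂ} (h : lam ∈ resolventSetOf T) :
    IsResolventAt T lam (resolventOf T lam) := by
  have h' : ∃ R : H →L[ℂ] H, IsResolventAt T lam R := h
  rw [resolventOf, dif_pos h']
  exact h'.choose_spec

end CuspSurface

end


/-! ### The resolvent approximation -/

open CuspSurface in
theorem theorem4p1 {M : Type*} [TopologicalSpace M] [T2Space M] [SigmaCompactSpace M]
    [ChartedSpace CuspSurface.Plane M] [IsManifold (𝓡 2) ∞ M]
    [MeasurableSpace M] [BorelSpace M]
    (Y : CuspSurface.CylindricalEnd M)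
    (g : Ioi (0 : ℝ) → CuspSurface.Metric M)
    (hg : ∀ a : Ioi (0 : ℝ),
      CuspSurface.IsWarpedOnEnd (g a) Y (fun x => (1 + x / (a : ℝ)) ^ (-(a : ℝ))))
    (gH : CuspSurface.Metric M)
    (hgH : CuspSurface.IsWarpedOnEnd gH Y (fun x => Real.exp (-x)))
    (φ : M → ℂ) (hφ : ContMDiff (𝓡 2) 𝓘(ℝ, ℂ) ∞ φ) (hφc : HasCompactSupport φ)
    (hφY : tsupport φ ⊆ Y.openEnd)
    (lam : ℂ) (hlam : lam ∈ CuspSurface.resolventSetOf (CuspSurface.closedLaplacian gH)) :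
    ∃ (hφ2 : MemLp φ 2 (CuspSurface.riemannianMeasure gH))
      (hψ2 : ∀ a : Ioi (0 : ℝ),
        MemLp (fun p => CuspSurface.laplacian (g a) φ p - lam * φ p) 2
          (CuspSurface.riemannianMeasure gH)),
      Tendsto (fun a : Ioi (0 : ℝ) =>
        ‖CuspSurface.resolventOf (CuspSurface.closedLaplacian gH) lam
          ((hψ2 a).toLp (fun p => CuspSurface.laplacian (g a) φ p - lam * φ p)) -
            hφ2.toLp φ‖) atTop (𝓝 0) := by
  set μ := riemannianMeasure gH
  have hapos : ∀ (a : Ioi (0 : ℝ)) (x : ℝ), 1 < x → 0 < (1 + x / (a : ℝ)) ^ (-(a : ℝ)) :=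
    fun a x hx => Real.rpow_pos_of_pos (powerProfile_base_pos a.2 hx) _
  have hasm : ∀ (a : Ioi (0 : ℝ)) (x : ℝ), 1 < x →
      ContDiffAt ℝ 2 (fun x => (1 + x / (a : ℝ)) ^ (-(a : ℝ))) x :=
    fun a x hx => contDiffAt_powerProfile a.2 hx
  have hHpos : ∀ x : ℝ, 1 < x → 0 < Real.exp (-x) := fun x _ => Real.exp_pos _
  have hHsm : ∀ x : ℝ, 1 < x → ContDiffAt ℝ 2 (fun x => Real.exp (-x)) x :=
    fun x _ => by fun_prop
  have hK : IsCompact (tsupport φ) := hφc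
  have hμK : μ (tsupport φ) < ⊤ := riemannianMeasure_lt_top hgH hHpos hHsm hK hφY
  have hca : ∀ a, Continuous (laplacian (g a) φ) := fun a =>
    continuous_laplacian (hg a) (hapos a) (hasm a) hφ hφY
  have hcH : Continuous (laplacian gH φ) := continuous_laplacian hgH hHpos hHsm hφ hφY
  have hcφ : Continuous φ := hφ.continuous
  have hφ0 : ∀ p ∉ tsupport φ, φ p = 0 := fun p hp => image_eq_zero_of_notMem_tsupport hp
  have hφ2 : MemLp φ 2 μ := memLp_two_of_continuous_of_support_subset hcφ hK hμK hφ0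
  have hH2 : MemLp (laplacian gH φ) 2 μ :=
    memLp_two_of_continuous_of_support_subset hcH hK hμK fun p hp => laplacian_eq_zero gH hp
  have hψ2 : ∀ a, MemLp (fun p => laplacian (g a) φ p - lam * φ p) 2 μ := fun a =>
    memLp_two_of_continuous_of_support_subset ((hca a).sub (continuous_const.mul hcφ)) hK hμK
      fun p hp => by simp [laplacian_eq_zero (g a) hp, hφ0 p hp]
  have hd0 : ∀ a, ∀ p ∉ tsupport φ, laplacian (g a) φ p - laplacian gH φ p = 0 :=
    fun a p hp => by simp [laplacian_eq_zero _ hp]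
  have hd2 : ∀ a, MemLp (fun p => laplacian (g a) φ p - laplacian gH φ p) 2 μ := fun a =>
    memLp_two_of_continuous_of_support_subset ((hca a).sub hcH) hK hμK (hd0 a)
  refine ⟨hφ2, hψ2, ?_⟩
  set R := resolventOf (closedLaplacian gH) lam
  have hmem : (hφ2.toLp φ, hH2.toLp (laplacian gH φ)) ∈ closedLaplacian gH := by
    refine Submodule.le_topologicalClosure _ (Submodule.subset_span ?_)
    exact ⟨φ, hφ, hφc, hφ2.coeFn_toLp, hH2.coeFn_toLp⟩
  -- By the characterization of the resolvent this says that `(φ, Δ_H φ)` is in the graph.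
  have hRφ : R (hH2.toLp (laplacian gH φ) - lam • hφ2.toLp φ) = hφ2.toLp φ := by
    rw [isResolventAt_resolventOf hlam, sub_add_cancel]
    exact hmem
  have hsplit : ∀ a, R ((hψ2 a).toLp (fun p => laplacian (g a) φ p - lam * φ p)) - hφ2.toLp φ =
      R ((hd2 a).toLp (fun p => laplacian (g a) φ p - laplacian gH φ p)) := by
    intro a
    conv_lhs => rw [← hRφ]
    rw [← map_sub]
    congr 1
    rw [← MemLp.toLp_const_smul, ← MemLp.toLp_sub, ← MemLp.toLp_sub]
    refine MemLp.toLp_congr _ _ (.of_forall fun p => ?_)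
    -- The two occurrences of `lam φ` cancel pointwise.
    simp
  obtain ⟨B, hB, hB1, hKB⟩ := Y.exists_isCompact_subset_image hK hφY
  set u : Plane → ℂ := fun w => φ (Y.param w) with hu
  obtain ⟨C, hC⟩ : ∃ C, ∀ q ∈ B,
      ‖pderiv 0 u q‖ + Real.exp (q 0) ^ 2 * ‖pderiv 1 (pderiv 1 u) q‖ ≤ C := by
    have hcont : ContinuousOn (fun q : Plane =>
        ‖pderiv 0 u q‖ + Real.exp (q 0) ^ 2 * ‖pderiv 1 (pderiv 1 u) q‖) B := by
      intro q hq
      have hsm := contDiffAt_comp_param Y hφ (hB1 q hq)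
      have h1 := (contDiffAt_pderiv hsm 0).continuousAt.norm
      have h2 := (continuousAt_pderiv_pderiv hsm 1 1).norm
      have h3 : ContinuousAt (fun q : Plane => Real.exp (q 0) ^ 2) q := by fun_prop
      exact (h1.add (h3.mul h2)).continuousWithinAt
    obtain ⟨C, hC⟩ := hB.exists_bound_of_continuousOn hcont
    exact ⟨C, fun q hq => (le_abs_self _).trans (hC q hq)⟩
  -- Dominated convergence needs a countably generated filter; here `atTop` is pulled back from `ℝ`.
  have : (atTop : Filter (Ioi (0 : ℝ))).IsCountablyGenerated := by
    rw [atTop_Ioi_eq]; infer_instance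
  have hlapa := fun (a : Ioi (0 : ℝ)) (q : Plane) (hq : 1 < q 0) =>
    laplacian_param (hg a) (hapos a) (hasm a) hφ hq
  have hlapH := fun (q : Plane) (hq : 1 < q 0) => laplacian_param hgH hHpos hHsm hφ hq
  have hlim : Tendsto (fun a => ‖(hd2 a).toLp (fun p => laplacian (g a) φ p - laplacian gH φ p)‖)
      atTop (𝓝 0) := by
    refine tendsto_norm_toLp_zero (fun a => (hca a).sub hcH) hK.isClosed.measurableSet hμK hd0
      (C := C) ?_ ?_ hd2
    · intro a p hp
      obtain ⟨q, hq, rfl⟩ := hKB hp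
      rw [Pi.sub_apply, hlapa a q (hB1 q hq), hlapH q (hB1 q hq)]
      exact (norm_warpedLaplacian_sub_le a.2 u (hB1 q hq)).trans (hC q hq)
    · intro p hp
      obtain ⟨q, hq, rfl⟩ := hKB hp
      have h1 := (tendsto_warpedLaplacian_sub u (hB1 q hq)).comp
        (tendsto_comp_val_Ioi_atTop.2 tendsto_id : Tendsto (fun a : Ioi (0 : ℝ) => (a : ℝ)) _ _)
      refine h1.congr fun a => ?_
      rw [Pi.sub_apply, hlapa a q (hB1 q hq), hlapH q (hB1 q hq)]
      rfl
  have hbound : Tendsto (fun a => ‖R‖ *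
      ‖(hd2 a).toLp (fun p => laplacian (g a) φ p - laplacian gH φ p)‖) atTop (𝓝 0) := by
    simpa using hlim.const_mul ‖R‖
  refine squeeze_zero (fun a => norm_nonneg _) (fun a => ?_) hbound
  rw [hsplit a]
  exact R.le_opNorm _
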